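/- Let $\alpha,\beta>-1$, let $K=[-1,1]$, and let $\mu$ be the measure $d\mu(x)=(1-x)^{\alpha}(1+x)^{\beta}\,dx$ on $K$. For a univariate real polynomial $f$ and $d\in\mathbb N=\{0,1,2,\dots\}$ let $$\underline f^{(d)}_K=\inf\Big\{\int_K \sigma(x) f(x)\,d\mu(x)\;:\;\sigma \text{ a sum of squares of real polynomials},\ \deg\sigma\le 2d,\ \int_K\sigma(x)\,d\mu(x)=1\Big\}$$ be the Lasserre bound of order $d$, and let $f_{\min,K}=\min_{x\in K}f(x)$. For $a,b>-1$ and $k\ge 1$ let $\xi^{a,b}_k$ denote the smallest real root of the Jacobi polynomial $$P^{a,b}_k(x)=\sum_{s=0}^{k}\binom{k+a}{k-s}\binom{k+b}{s}\Big(\frac{x-1}{2}\Big)^{s}\Big(\frac{x+1}{2}\Big)^{k-s}$$ (the polynomials of degree $k$ that are orthogonal on $[-1,1]$ with respect to the weight $(1-x)^a(1+x)^b$). Then, for every $d\in\mathbb N$: 1. if $f(x)=x$, then $\underline f^{(d)}_K=\xi^{\alpha,\beta}_{d+1}$; 2. if $f(x)=-x$, then $\underline f^{(d)}_K=\xi^{\beta,\alpha}_{d+1}$.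 Here the feasible set is non-empty, the infimum is finite, and the smallest roots exist. Consequently, for both $f(x)=x$ and $f(x)=-x$, one has $\underline f^{(d)}_K\ge f_{\min,K}$ for every $d$, and $$\underline f^{(d)}_K-f_{\min,K}=\Theta(1/d^2)\qquad(d\to\infty)$$ (for fixed $\alpha,\beta$). In particular, if $\alpha=\beta=-\tfrac12$, then for both choices of $f$ and every $d\in\mathbb N$, $$\underline f^{(d)}_K=-\cos\Big(\frac{\pi}{2d+2}\Big).$$ -/

import Mathlib

open MeasureTheory Polynomial Asymptotics Filter

/-- The Jacobi weight `(1 - x)^α (1 + x)^β` (only its values on `(-1, 1)` matter below). -/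
noncomputable def jacobiWeight (α β x : ℝ) : ℝ :=
  (1 - x) ^ α * (1 + x) ^ β

/-- The measure `(1 - x)^α (1 + x)^β dx` on `(-1, 1)`, viewed as a measure on the real line. -/
noncomputable def jacobiMeasure (α β : ℝ) : Measure ℝ :=
  (volume.restrict (Set.Ioo (-1) 1)).withDensity fun x => ENNReal.ofReal (jacobiWeight α β x)

/-- The classical Jacobi polynomial
`P_n^{α,β}(x) = ∑_{s=0}^n C(n+α, n-s) C(n+β, s) ((x-1)/2)^s ((x+1)/2)^{n-s}`,
with generalised binomial coefficients `C(a, m) = a (a-1) ⋯ (a-m+1) / m!`. -/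
noncomputable def jacobiPoly (α β : ℝ) (n : ℕ) : ℝ[X] :=
  ∑ s ∈ Finset.range (n + 1),
    C (Ring.choose ((n : ℝ) + α) (n - s) * Ring.choose ((n : ℝ) + β) s) *
      (C (1 / 2) * (X - 1)) ^ s * (C (1 / 2) * (X + 1)) ^ (n - s)

/-- The values `∫_K σ f dμ` attained by the feasible densities `σ`: sums of squares of polynomials,
of degree at most `2 d`, with `∫_K σ dμ = 1`. -/
def lasserreValues (K : Set ℝ) (μ : Measure ℝ) (f : ℝ[X]) (d : ℕ) : Set ℝ :=
  {v | ∃ σ : ℝ[X], IsSumSq σ ∧ σ.natDegree ≤ 2 * d ∧ ∫ x in K, σ.eval x ∂μ = 1 ∧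
    ∫ x in K, σ.eval x * f.eval x ∂μ = v}

/-- The Lasserre bound of order `d` for minimising `f` over `K`, with reference measure `μ`. -/
noncomputable def lasserreBound (K : Set ℝ) (μ : Measure ℝ) (f : ℝ[X]) (d : ℕ) : ℝ :=
  sInf (lasserreValues K μ f d)

/-- The minimum of the polynomial `f` over the (nonempty compact) set `K`. -/
noncomputable def polyMin (K : Set ℝ) (f : ℝ[X]) : ℝ :=
  sInf ((fun x => f.eval x) '' K)

/-! Write `Λ p` for the integral of `p` against the Jacobi weight. Leading terms of squares cannot
cancel, so a sum of squares of degree at most `2 * d` is a sum of squares of polynomials of degree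
at most `d`. For `f = X` the bound is therefore the minimum `l` of `Λ (X q²) / Λ (q²)`, attained by
compactness at some `p`. Stationarity makes `(X - l) p`, of degree at most `d + 1`, orthogonal to
all degrees at most `d`, hence a multiple of the orthogonal polynomial `P` of degree `d + 1`; so `l`
is a root of `P`. Conversely, a root `x` gives `P = (X - x) q`, and `Λ (P q) = 0` says that the
quotient at `q` is `x`; so `l ≤ x`. No quadrature rule is needed. Orthogonality of `jacobiPoly`
reduces, through Beta integrals, to the vanishing of an `n`-th difference. The reflection `x ↦ -x`
exchanges `α` and `β`, which settles `f = -X`. For the rate, let `S` and `S2` be the sums of `(1 +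
x)⁻¹` and `(1 + x)⁻¹ ^ 2` over the roots `x` of `P`, all real and above `-1`. Then `S2 / S ≤ (1 +
l)⁻¹ ≤ S`, and both ends, computed from the first two derivatives of `P` at `-1`, grow like `d²`. -/

/-! ### Rayleigh quotients and least roots -/

/-- The Rayleigh quotient `Λ (X q²) / Λ (q²)` of a positive functional attains its minimum over the
nonzero polynomials of degree at most `d`. -/
theorem exists_rayleigh_minimizer (Λ : ℝ[X] →ₗ[ℝ] ℝ) (hpos : ∀ p : ℝ[X], p ≠ 0 → 0 < Λ (p * p))
    (d : ℕ) : ∃ p : ℝ[X], p ≠ 0 ∧ p.natDegree ≤ d ∧ ∀ q : ℝ[X], q.natDegree ≤ d →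
      Λ (X * (p * p)) / Λ (p * p) * Λ (q * q) ≤ Λ (X * (q * q)) := by
  let φ : (Fin (d + 1) → ℝ) → ℝ[X] := fun c => ∑ i, c i • (X : ℝ[X]) ^ (i : ℕ)
  have hcoeff : ∀ c (i : Fin (d + 1)), (φ c).coeff i = c i := by
    intro c i
    simp only [φ, finsetSum_coeff, coeff_smul, coeff_X_pow, smul_eq_mul, mul_ite, mul_one, mul_zero]
    rw [Finset.sum_eq_single i]
    · simp
    · intro b _ hb
      rw [if_neg (fun h => hb (Fin.ext h.symm))]
    · simp
  have hφ0 : ∀ c, c ≠ 0 → φ c ≠ 0 := by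
    intro c hc h
    apply hc
    ext i
    rw [← hcoeff c i, h]
    simp
  have hdeg : ∀ c, (φ c).natDegree ≤ d := by
    intro c
    refine natDegree_sum_le_of_forall_le _ _ fun i _ => ?_
    exact (natDegree_smul_le _ _).trans ((natDegree_X_pow_le _).trans (Nat.le_of_lt_succ i.2))
  have hsurj : ∀ q : ℝ[X], q.natDegree ≤ d → φ (fun i => q.coeff i) = q := by
    intro q hq
    conv_rhs => rw [q.as_sum_range' (d + 1) (Nat.lt_succ_of_le hq)]
    rw [Finset.sum_range]
    refine Finset.sum_congr rfl fun i _ => ?_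
    rw [smul_eq_C_mul, C_mul_X_pow_eq_monomial]
  have hsmul : ∀ (t : ℝ) c, φ (t • c) = t • φ c := by
    intro t c
    simp only [φ, Pi.smul_apply, Finset.smul_sum, smul_smul, smul_eq_mul]
  have hcont : ∀ r : ℝ[X], Continuous fun c => Λ (r * (φ c * φ c)) := by
    intro r
    simp only [φ, Finset.sum_mul, Finset.mul_sum, map_sum, smul_mul_assoc, mul_smul_comm, map_smul]
    fun_prop
  have hB : ∀ c, c ≠ 0 → 0 < Λ (φ c * φ c) := fun c hc => hpos _ (hφ0 c hc)
  -- The quotient is invariant under scaling of `c`, so a minimum over the unit sphere is global.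
  obtain ⟨c, hc, hmin⟩ := (isCompact_sphere (0 : Fin (d + 1) → ℝ) 1).exists_isMinOn
    (NormedSpace.sphere_nonempty.2 zero_le_one)
    (f := fun c => Λ (X * (φ c * φ c)) / Λ (φ c * φ c)) (by
      refine ContinuousOn.div (hcont X).continuousOn ?_ fun c hc => ?_
      · simpa using (hcont 1).continuousOn
      · exact (hB c (ne_zero_of_mem_unit_sphere ⟨c, hc⟩)).ne')
  have hc0 : c ≠ 0 := ne_zero_of_mem_unit_sphere ⟨c, hc⟩
  refine ⟨φ c, hφ0 c hc0, hdeg c, fun q hq => ?_⟩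
  by_cases hq0 : q = 0
  · simp [hq0]
  set e : Fin (d + 1) → ℝ := fun i => q.coeff i with he
  have hφe : φ e = q := hsurj q hq
  have he0 : e ≠ 0 := by
    intro h
    apply hq0
    rw [← hφe, h]
    simp [φ]
  have hn : ‖e‖ ≠ 0 := norm_ne_zero_iff.2 he0
  have hmem : (‖e‖⁻¹ • e) ∈ Metric.sphere (0 : Fin (d + 1) → ℝ) 1 := by
    simp [norm_smul, hn]
  have h := hmin hmem
  simp only [Set.mem_ofPred_eq, hsmul, hφe, smul_mul_assoc, mul_smul_comm, map_smul,
    smul_eq_mul] at h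
  have hq' := hpos q hq0
  rw [mul_div_mul_left _ _ (inv_ne_zero hn), mul_div_mul_left _ _ (inv_ne_zero hn)] at h
  rwa [← le_div_iff₀ hq']

/-- The least root of an orthogonal polynomial of degree `d + 1` is the minimum of the Rayleigh
quotient `Λ (X q²) / Λ (q²)` over the polynomials of degree at most `d`. -/
theorem exists_isLeast_root_of_orthogonal (Λ : ℝ[X] →ₗ[ℝ] ℝ)
    (hpos : ∀ p : ℝ[X], p ≠ 0 → 0 < Λ (p * p)) {d : ℕ} {P : ℝ[X]} (hP : P.natDegree = d + 1)
    (horth : ∀ q : ℝ[X], q.natDegree ≤ d → Λ (P * q) = 0) :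
    ∃ l, IsLeast {x | P.IsRoot x} l ∧
      (∃ p : ℝ[X], p ≠ 0 ∧ p.natDegree ≤ d ∧ Λ (X * (p * p)) = l * Λ (p * p)) ∧
      ∀ q : ℝ[X], q.natDegree ≤ d → l * Λ (q * q) ≤ Λ (X * (q * q)) := by
  obtain ⟨p, hp0, hpd, hmin⟩ := exists_rayleigh_minimizer Λ hpos d
  set l := Λ (X * (p * p)) / Λ (p * p) with hl
  have hpp := hpos p hp0
  have hlp : Λ (X * (p * p)) = l * Λ (p * p) := by
    rw [hl, div_mul_cancel₀ _ hpp.ne']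
  have hP0 : P ≠ 0 := by
    rintro rfl
    simp at hP
  have hsub : ∀ (c : ℝ) (r : ℝ[X]), Λ ((X - C c) * r) = Λ (X * r) - c * Λ r := by
    intro c r
    rw [sub_mul, map_sub, ← smul_eq_C_mul, map_smul, smul_eq_mul]
  -- stationarity of the minimiser
  have hstat : ∀ q : ℝ[X], q.natDegree ≤ d → Λ ((X - C l) * p * q) = 0 := by
    intro q hq
    set b := Λ ((X - C l) * p * q) with hb
    set a := Λ ((X - C l) * (q * q)) with ha
    have key : ∀ t : ℝ, 0 ≤ a * (t * t) + 2 * b * t + 0 := by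
      intro t
      have h1 := hmin (p + C t * q) ((natDegree_add_le _ _).trans
        (max_le hpd ((natDegree_C_mul_le _ _).trans hq)))
      have h2 : 0 ≤ Λ ((X - C l) * ((p + C t * q) * (p + C t * q))) := by
        rw [hsub]
        linarith
      have h3 : (X - C l) * ((p + C t * q) * (p + C t * q)) =
          (X - C l) * (p * p) + (2 * t) • ((X - C l) * p * q)
            + (t * t) • ((X - C l) * (q * q)) := by
        simp only [smul_eq_C_mul, C_mul, map_ofNat]
        ring
      rw [h3, map_add, map_add, map_smul, map_smul, ← hb, ← ha, hsub, hlp] at h2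
      simp only [smul_eq_mul] at h2
      linarith
    -- A quadratic in `t` that is nonnegative and has no constant term has discriminant `4 b² ≤ 0`.
    have := discrim_le_zero key
    simp only [discrim] at this
    nlinarith
  -- the minimiser spans the orthogonal complement together with `P`
  set r := (X - C l) * p with hr
  have hrdeg : r.natDegree ≤ d + 1 := by
    rw [hr, natDegree_mul (X_sub_C_ne_zero l) hp0, natDegree_X_sub_C]
    omega
  set c := r.coeff (d + 1) / P.coeff (d + 1) with hc
  have hPc : P.coeff (d + 1) ≠ 0 := by
    rw [← hP]
    exact leadingCoeff_ne_zero.2 hP0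
  have hs : (r - C c * P).natDegree ≤ d := by
    have h1 : (r - C c * P).natDegree ≤ d + 1 :=
      (natDegree_sub_le _ _).trans (max_le hrdeg ((natDegree_C_mul_le _ _).trans hP.le))
    refine (natDegree_le_pred h1 ?_).trans (by simp)
    rw [coeff_sub, coeff_C_mul, hc, div_mul_cancel₀ _ hPc, sub_self]
  -- The remainder has degree at most `d` and is orthogonal to that whole space, hence to itself.
  have hs0 : r - C c * P = 0 := by
    by_contra h
    have h1 := hpos _ h
    have h2 : Λ ((r - C c * P) * (r - C c * P)) =
        Λ (r * (r - C c * P)) - c * Λ (P * (r - C c * P)) := by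
      rw [sub_mul, map_sub, mul_assoc (C c), ← smul_eq_C_mul (a := c) (p := P * _), map_smul,
        smul_eq_mul]
    rw [h2, hstat _ hs, horth _ hs] at h1
    simp at h1
  have hroot : P.IsRoot l := by
    have h1 : r = C c * P := sub_eq_zero.1 hs0
    have hc0 : c ≠ 0 := by
      intro h
      rw [h, C_0, zero_mul, hr] at h1
      exact (mul_ne_zero (X_sub_C_ne_zero l) hp0) h1
    have h2 : r.eval l = 0 := by simp [hr]
    rw [h1, eval_mul, eval_C] at h2
    exact (mul_eq_zero.1 h2).resolve_left hc0
  refine ⟨l, ⟨hroot, fun x hx => ?_⟩, ⟨p, hp0, hpd, hlp⟩, hmin⟩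
  -- The cofactor of a root `x` is a competitor whose Rayleigh quotient is exactly `x`.
  obtain ⟨q, hq⟩ := dvd_iff_isRoot.2 hx
  have hq0 : q ≠ 0 := by
    rintro rfl
    exact hP0 (by simpa using hq)
  have hqd : q.natDegree ≤ d := by
    have := congrArg natDegree hq
    rw [hP, natDegree_mul (X_sub_C_ne_zero x) hq0, natDegree_X_sub_C] at this
    omega
  have h1 : Λ ((X - C x) * (q * q)) = 0 := by
    rw [← mul_assoc, ← hq]
    exact horth q hqd
  rw [hsub] at h1
  have h2 := hmin q hqd
  have h3 := hpos q hq0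
  exact le_of_mul_le_mul_right (by linarith) h3

/-! ### Degrees in sums of squares -/

theorem leadingCoeff_nonneg_of_isSumSq {σ : ℝ[X]} (h : IsSumSq σ) : 0 ≤ σ.leadingCoeff := by
  induction h with
  | zero => simp
  | sq_add a hs ih =>
    rename_i s
    rcases lt_trichotomy (a * a).degree s.degree with h | h | h
    · rwa [leadingCoeff_add_of_degree_lt h]
    · by_cases h0 : (a * a).leadingCoeff + s.leadingCoeff = 0
      · have h1 : 0 ≤ (a * a).leadingCoeff := by
          rw [leadingCoeff_mul]; exact mul_self_nonneg _
        have h2 : (a * a).leadingCoeff = 0 := by linarith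
        rw [leadingCoeff_eq_zero.1 h2]
        simpa using ih
      · rw [leadingCoeff_add_of_degree_eq h h0, leadingCoeff_mul]
        exact add_nonneg (mul_self_nonneg _) ih
    · rw [leadingCoeff_add_of_degree_lt' h, leadingCoeff_mul]
      exact mul_self_nonneg _

/-- No cancellation of leading terms takes place in the sum of a square and a sum of squares. -/
theorem natDegree_le_of_isSumSq {a s : ℝ[X]} (hs : IsSumSq s) :
    (a * a).natDegree ≤ (a * a + s).natDegree ∧ s.natDegree ≤ (a * a + s).natDegree := by
  rcases lt_trichotomy (a * a).degree s.degree with h | h | h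
  · have := natDegree_eq_of_degree_eq (degree_add_eq_right_of_degree_lt h)
    rw [this]
    exact ⟨natDegree_le_natDegree h.le, le_rfl⟩
  · by_cases h0 : (a * a).leadingCoeff + s.leadingCoeff = 0
    · have h1 : 0 ≤ (a * a).leadingCoeff := by
        rw [leadingCoeff_mul]; exact mul_self_nonneg _
      have h3 := leadingCoeff_nonneg_of_isSumSq hs
      have h2 : (a * a).leadingCoeff = 0 := by linarith
      have h4 : s.leadingCoeff = 0 := by linarith
      rw [leadingCoeff_eq_zero.1 h2, leadingCoeff_eq_zero.1 h4]
      simp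
    · have h1 : (a * a + s).degree = s.degree := by
        rw [degree_add_eq_of_leadingCoeff_add_ne_zero h0, h, max_self]
      rw [natDegree_eq_of_degree_eq h1]
      exact ⟨(natDegree_eq_of_degree_eq h).le, le_rfl⟩
  · have := natDegree_eq_of_degree_eq (degree_add_eq_left_of_degree_lt h)
    rw [this]
    exact ⟨le_rfl, natDegree_le_natDegree h.le⟩

/-- Each squared summand inherits the degree bound, so the inequality for single squares can be
added up. -/
theorem mul_le_of_isSumSq (Λ : ℝ[X] →ₗ[ℝ] ℝ) {d : ℕ} {l : ℝ}
    (h : ∀ q : ℝ[X], q.natDegree ≤ d → l * Λ (q * q) ≤ Λ (X * (q * q))) {σ : ℝ[X]}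
    (hσ : IsSumSq σ) (hd : σ.natDegree ≤ 2 * d) : l * Λ σ ≤ Λ (X * σ) := by
  induction hσ with
  | zero => simp
  | sq_add a hs ih =>
    obtain ⟨h1, h2⟩ := natDegree_le_of_isSumSq (a := a) hs
    have h3 := ih (h2.trans hd)
    have h4 : a.natDegree ≤ d := by
      have := h1.trans hd
      rw [← sq, natDegree_pow] at this
      omega
    have h5 := h a h4
    rw [mul_add X, map_add, map_add]
    linarith

/-! ### Location of the roots -/

/-- The roots of an orthogonal polynomial are real and lie in the open interval carrying the
positive functional. -/
theorem splits_of_orthogonal (Λ : ℝ[X] →ₗ[ℝ] ℝ)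
    (hpos : ∀ r : ℝ[X], r ≠ 0 → (∀ x ∈ Set.Ioo (-1 : ℝ) 1, 0 ≤ r.eval x) → 0 < Λ r)
    {P : ℝ[X]} (hP : P ≠ 0) (horth : ∀ q : ℝ[X], q.natDegree < P.natDegree → Λ (P * q) = 0) :
    P.Splits := by
  suffices H : ∀ g : ℝ[X], Irreducible g → g ∣ P → g.degree = 1 by
    obtain ⟨u, hu⟩ := UniqueFactorizationMonoid.factors_prod hP
    rw [← hu]
    refine (Splits.multisetProd fun g hg => ?_).mul u.isUnit.splits
    exact Splits.of_degree_eq_one (H g (UniqueFactorizationMonoid.irreducible_of_factor g hg)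
      (UniqueFactorizationMonoid.dvd_of_mem_factors hg))
  intro g hg hdvd
  have hle := hg.degree_le_two
  have hgpos := hg.natDegree_pos
  have hnat : g.natDegree ≤ 2 := natDegree_le_of_degree_le hle
  have hcases : g.natDegree = 1 ∨ g.natDegree = 2 := by omega
  rcases hcases with h1 | h2
  · rw [degree_eq_natDegree hg.ne_zero, h1]
    rfl
  -- An irreducible quadratic factor `g` has constant sign. With `P = g * r`, the polynomial `P * r
  -- = g * r²` then has constant sign too, against `Λ (P * r) = 0`.
  exfalso
  obtain ⟨r, rfl⟩ := hdvd
  have hg0 := hg.ne_zero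
  have hr0 : r ≠ 0 := right_ne_zero_of_mul hP
  have hz := horth r (by rw [natDegree_mul hg0 hr0]; omega)
  have hne : ∀ x, g.eval x ≠ 0 := by
    intro x hx
    have := degree_eq_one_of_irreducible_of_root hg (show g.IsRoot x from hx)
    rw [degree_eq_natDegree hg.ne_zero, h2] at this
    norm_cast at this
  have hprod : g * r * r ≠ 0 := mul_ne_zero hP hr0
  have hsign : (∀ x, 0 < g.eval x) ∨ (∀ x, g.eval x < 0) := by
    by_contra hcon
    push Not at hcon
    obtain ⟨⟨a, ha⟩, b, hb⟩ := hcon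
    obtain ⟨x, hx⟩ := mem_range_of_exists_le_of_exists_ge g.continuous ⟨a, ha⟩ ⟨b, hb⟩
    exact hne x hx
  rcases hsign with h | h
  · have := hpos _ hprod fun x _ => by
      rw [eval_mul, eval_mul, mul_assoc]
      exact mul_nonneg (h x).le (mul_self_nonneg _)
    linarith
  · have := hpos _ (neg_ne_zero.2 hprod) fun x _ => by
      rw [eval_neg, eval_mul, eval_mul, mul_assoc]
      exact neg_nonneg.2 (mul_nonpos_of_nonpos_of_nonneg (h x).le (mul_self_nonneg _))
    rw [map_neg] at this
    linarith

/-- If `x ≤ -1` and `P = (X - x) q`, then `P * q = (X - x) q²` is nonnegative on the interval, so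
its integral cannot vanish. -/
theorem neg_one_lt_of_isRoot_of_orthogonal (Λ : ℝ[X] →ₗ[ℝ] ℝ)
    (hpos : ∀ r : ℝ[X], r ≠ 0 → (∀ x ∈ Set.Ioo (-1 : ℝ) 1, 0 ≤ r.eval x) → 0 < Λ r)
    {P : ℝ[X]} (hP : P ≠ 0) (horth : ∀ q : ℝ[X], q.natDegree < P.natDegree → Λ (P * q) = 0)
    {x : ℝ} (hx : P.IsRoot x) : -1 < x := by
  by_contra! hle
  obtain ⟨q, rfl⟩ := dvd_iff_isRoot.2 hx
  have hq0 : q ≠ 0 := right_ne_zero_of_mul hP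
  have h1 := horth q (by rw [natDegree_mul (X_sub_C_ne_zero x) hq0, natDegree_X_sub_C]; omega)
  have h2 := hpos _ (mul_ne_zero hP hq0) fun y hy => by
    rw [eval_mul, eval_mul, mul_assoc]
    refine mul_nonneg ?_ (mul_self_nonneg _)
    simp only [eval_sub, eval_X, eval_C]
    linarith [hy.1]
  linarith

/-- The derivatives of a product of linear factors, in terms of the power sums of `(a - xᵢ)⁻¹`. -/
theorem eval_derivative_prod_X_sub_C (a : ℝ) (M : Multiset ℝ) (h : ∀ x ∈ M, a ≠ x) :
    (derivative (M.map fun x => X - C x).prod).eval a =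
        (M.map fun x => (a - x)⁻¹).sum * ((M.map fun x => X - C x).prod).eval a ∧
      (derivative (derivative (M.map fun x => X - C x).prod)).eval a =
        ((M.map fun x => (a - x)⁻¹).sum ^ 2 - (M.map fun x => (a - x)⁻¹ ^ 2).sum) *
          ((M.map fun x => X - C x).prod).eval a := by
  induction M using Multiset.induction_on with
  | empty => simp
  | cons x M ih =>
    obtain ⟨h1, h2⟩ := ih fun y hy => h y (Multiset.mem_cons_of_mem hy)
    have hx : a - x ≠ 0 := sub_ne_zero.2 (h x (Multiset.mem_cons_self x M))
    simp only [Multiset.map_cons, Multiset.prod_cons, Multiset.sum_cons, derivative_mul,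
      derivative_sub, derivative_X, derivative_C, derivative_add, eval_add, eval_mul, eval_sub,
      eval_X, eval_C, sub_zero, one_mul, h1, h2]
    constructor
    · field_simp
    · field_simp
      ring

/-! ### The Jacobi weight and its Beta integrals -/

theorem jacobiWeight_pos (α β : ℝ) {x : ℝ} (hx : x ∈ Set.Ioo (-1 : ℝ) 1) :
    0 < jacobiWeight α β x :=
  mul_pos (Real.rpow_pos_of_pos (by linarith [hx.2]) _) (Real.rpow_pos_of_pos (by linarith [hx.1]) _)

theorem measurable_jacobiWeight (α β : ℝ) : Measurable (jacobiWeight α β) := by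
  unfold jacobiWeight
  fun_prop

theorem setIntegral_Icc_jacobiMeasure (α β : ℝ) (f : ℝ → ℝ) :
    ∫ x in Set.Icc (-1) 1, f x ∂jacobiMeasure α β = ∫ x in (-1)..1, jacobiWeight α β x * f x := by
  rw [jacobiMeasure, restrict_withDensity measurableSet_Icc,
    Measure.restrict_restrict measurableSet_Icc,
    Set.inter_eq_self_of_subset_right Set.Ioo_subset_Icc_self,
    integral_withDensity_eq_integral_toReal_smul
      (measurable_jacobiWeight α β).ennreal_ofReal (by simp),
    intervalIntegral.integral_of_le (by norm_num), integral_Ioc_eq_integral_Ioo]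
  refine setIntegral_congr_fun measurableSet_Ioo fun x hx => ?_
  simp only [smul_eq_mul]
  rw [ENNReal.toReal_ofReal (jacobiWeight_pos α β hx).le]

/-- This is the real part of the convergent complex Beta integrand with parameters `a + 1`, `b + 1`.
-/
theorem intervalIntegrable_rpow_mul_one_sub_rpow {a b : ℝ} (ha : -1 < a) (hb : -1 < b) :
    IntervalIntegrable (fun t : ℝ => t ^ a * (1 - t) ^ b) volume 0 1 := by
  have h := Complex.betaIntegral_convergent (u := ((a + 1 : ℝ) : ℂ)) (v := ((b + 1 : ℝ) : ℂ))
    (by rw [Complex.ofReal_re]; linarith) (by rw [Complex.ofReal_re]; linarith)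
  rw [intervalIntegrable_iff_integrableOn_Ioc_of_le zero_le_one] at h ⊢
  refine (integrableOn_congr_fun (fun t ht => ?_) measurableSet_Ioc).1 h.re
  have h1 : ((a + 1 : ℝ) : ℂ) - 1 = (a : ℝ) := by push_cast; ring
  have h2 : ((b + 1 : ℝ) : ℂ) - 1 = (b : ℝ) := by push_cast; ring
  have h3 : (1 : ℂ) - (t : ℂ) = ((1 - t : ℝ) : ℂ) := by push_cast; ring
  simp only [h1, h2, h3]
  rw [← Complex.ofReal_cpow ht.1.le, ← Complex.ofReal_cpow (by linarith [ht.2]),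
    ← Complex.ofReal_mul]
  exact Complex.ofReal_re _

theorem integral_rpow_mul_one_sub_rpow {a b : ℝ} (ha : -1 < a) (hb : -1 < b) :
    ∫ t : ℝ in (0)..1, t ^ a * (1 - t) ^ b = ProbabilityTheory.beta (a + 1) (b + 1) := by
  have h := Complex.betaIntegral_eq_Gamma_mul_div ((a + 1 : ℝ) : ℂ) ((b + 1 : ℝ) : ℂ)
    (by rw [Complex.ofReal_re]; linarith) (by rw [Complex.ofReal_re]; linarith)
  have h2 : Complex.betaIntegral ((a + 1 : ℝ) : ℂ) ((b + 1 : ℝ) : ℂ) =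
      ((∫ t : ℝ in (0)..1, t ^ a * (1 - t) ^ b : ℝ) : ℂ) := by
    rw [Complex.betaIntegral, ← intervalIntegral.integral_ofReal,
      intervalIntegral.integral_of_le zero_le_one, intervalIntegral.integral_of_le zero_le_one]
    refine setIntegral_congr_fun measurableSet_Ioc fun t ht => ?_
    have h1 : ((a + 1 : ℝ) : ℂ) - 1 = (a : ℝ) := by push_cast; ring
    have h2 : ((b + 1 : ℝ) : ℂ) - 1 = (b : ℝ) := by push_cast; ring
    have h3 : (1 : ℂ) - (t : ℂ) = ((1 - t : ℝ) : ℂ) := by push_cast; ring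
    simp only [h1, h2, h3]
    rw [← Complex.ofReal_cpow ht.1.le, ← Complex.ofReal_cpow (by linarith [ht.2]),
      ← Complex.ofReal_mul]
  rw [h2, ← Complex.ofReal_add, Complex.Gamma_ofReal, Complex.Gamma_ofReal,
    Complex.Gamma_ofReal] at h
  rw [ProbabilityTheory.beta]
  exact_mod_cast h

/-- The substitution `x = 2 * t - 1` leads to the Beta integrand; `β` goes with `t` because `1 + x =
2 * t`. -/
theorem jacobiWeight_affine (α β : ℝ) {t : ℝ} (ht : t ∈ Set.Icc (0 : ℝ) 1) :
    jacobiWeight α β (2 * t - 1) = 2 ^ (α + β) * (t ^ β * (1 - t) ^ α) := by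
  rw [jacobiWeight, show 1 - (2 * t - 1) = 2 * (1 - t) by ring,
    show 1 + (2 * t - 1) = 2 * t by ring, Real.mul_rpow zero_le_two (by linarith [ht.2]),
    Real.mul_rpow zero_le_two ht.1, Real.rpow_add two_pos]
  ring

theorem intervalIntegrable_jacobiWeight {α β : ℝ} (hα : -1 < α) (hβ : -1 < β) :
    IntervalIntegrable (jacobiWeight α β) volume (-1) 1 := by
  have h := (intervalIntegrable_rpow_mul_one_sub_rpow hβ hα).const_mul (2 ^ (α + β))
  have h1 : IntervalIntegrable (fun t => jacobiWeight α β (2 * t - 1)) volume 0 1 := by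
    refine h.congr ?_
    intro t ht
    rw [Set.uIoc_of_le zero_le_one] at ht
    exact (jacobiWeight_affine α β ⟨ht.1.le, ht.2⟩).symm
  have h2 := (h1.comp_mul_right (c := 1 / 2)).comp_add_right 1
  convert h2 using 1
  · ext x
    congr 1
    ring
  · norm_num
  · norm_num

theorem integral_jacobiWeight {α β : ℝ} (hα : -1 < α) (hβ : -1 < β) :
    ∫ x in (-1)..1, jacobiWeight α β x =
      2 ^ (α + β + 1) * ProbabilityTheory.beta (α + 1) (β + 1) := by
  have h := intervalIntegral.mul_integral_comp_mul_sub (a := 0) (b := 1)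
    (f := jacobiWeight α β) 2 1
  rw [show (2 : ℝ) * 0 - 1 = -1 by norm_num, show (2 : ℝ) * 1 - 1 = 1 by norm_num] at h
  rw [← h]
  have h1 : ∫ t in (0 : ℝ)..1, jacobiWeight α β (2 * t - 1) =
      ∫ t in (0 : ℝ)..1, 2 ^ (α + β) * (t ^ β * (1 - t) ^ α) := by
    refine intervalIntegral.integral_congr fun t ht => ?_
    rw [Set.uIcc_of_le zero_le_one] at ht
    exact jacobiWeight_affine α β ht
  rw [h1, intervalIntegral.integral_const_mul, integral_rpow_mul_one_sub_rpow hβ hα,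
    Real.rpow_add_one two_ne_zero, ProbabilityTheory.beta, ProbabilityTheory.beta,
    add_comm (β + 1)]
  ring

theorem intervalIntegrable_jacobiWeight_mul {α β : ℝ} (hα : -1 < α) (hβ : -1 < β) (p : ℝ[X]) :
    IntervalIntegrable (fun x => jacobiWeight α β x * p.eval x) volume (-1) 1 :=
  (intervalIntegrable_jacobiWeight hα hβ).mul_continuousOn p.continuous.continuousOn

/-- Integration of polynomials against the Jacobi weight. -/
noncomputable def jacobiFunctional {α β : ℝ} (hα : -1 < α) (hβ : -1 < β) : ℝ[X] →ₗ[ℝ] ℝ where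
  toFun p := ∫ x in (-1)..1, jacobiWeight α β x * p.eval x
  map_add' p q := by
    rw [← intervalIntegral.integral_add (intervalIntegrable_jacobiWeight_mul hα hβ p)
      (intervalIntegrable_jacobiWeight_mul hα hβ q)]
    simp only [eval_add, mul_add]
  map_smul' c p := by
    simp only [eval_smul, smul_eq_mul, RingHom.id_apply]
    rw [← intervalIntegral.integral_const_mul]
    congr 1
    ext x
    ring

theorem jacobiFunctional_apply {α β : ℝ} (hα : -1 < α) (hβ : -1 < β) (p : ℝ[X]) :
    jacobiFunctional hα hβ p = ∫ x in (-1)..1, jacobiWeight α β x * p.eval x := rfl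

theorem jacobiFunctional_pos {α β : ℝ} (hα : -1 < α) (hβ : -1 < β) {r : ℝ[X]} (hr : r ≠ 0)
    (h : ∀ x ∈ Set.Ioo (-1 : ℝ) 1, 0 ≤ r.eval x) : 0 < jacobiFunctional hα hβ r := by
  rw [jacobiFunctional_apply]
  refine (intervalIntegral.integral_pos_iff_support_of_nonneg_ae' ?_
    (intervalIntegrable_jacobiWeight_mul hα hβ r)).2 ⟨by norm_num, ?_⟩
  · rw [Set.uIoc_of_le (by norm_num), ← restrict_Ioo_eq_restrict_Ioc]
    filter_upwards [ae_restrict_mem measurableSet_Ioo] with x hx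
    exact mul_nonneg (jacobiWeight_pos α β hx).le (h x hx)
  · have hfin : volume ({x | r.IsRoot x}) = 0 := (finite_setOfPred_isRoot hr).measure_zero _
    have hsub : Set.Ioo (-1 : ℝ) 1 \ {x | r.IsRoot x} ⊆
        Function.support (fun x => jacobiWeight α β x * r.eval x) ∩ Set.Ioc (-1) 1 := by
      intro x hx
      exact ⟨mul_ne_zero (jacobiWeight_pos α β hx.1).ne' hx.2, hx.1.1, hx.1.2.le⟩
    refine lt_of_lt_of_le ?_ (measure_mono hsub)
    rw [measure_sdiff_null hfin, Real.volume_Ioo]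
    norm_num

/-- The two powers only shift `α` by `i` and `β` by `j`; the factors `2 ^ (i + j)` cancel. -/
theorem jacobiFunctional_pow_mul_pow {α β : ℝ} (hα : -1 < α) (hβ : -1 < β) (i j : ℕ) :
    jacobiFunctional hα hβ ((C (1 / 2) * (1 - X)) ^ i * (C (1 / 2) * (X + 1)) ^ j) =
      2 ^ (α + β + 1) * ProbabilityTheory.beta (α + i + 1) (β + j + 1) := by
  rw [jacobiFunctional_apply]
  have hi : -1 < α + i := by linarith [(Nat.cast_nonneg i : (0 : ℝ) ≤ i)]
  have hj : -1 < β + j := by linarith [(Nat.cast_nonneg j : (0 : ℝ) ≤ j)]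
  have h : ∫ x in (-1 : ℝ)..1, jacobiWeight α β x *
        ((C (1 / 2) * (1 - X)) ^ i * (C (1 / 2) * (X + 1)) ^ j : ℝ[X]).eval x =
      ∫ x in (-1 : ℝ)..1, (1 / 2) ^ (i + j) * jacobiWeight (α + i) (β + j) x := by
    rw [intervalIntegral.integral_of_le (by norm_num), intervalIntegral.integral_of_le (by norm_num),
      integral_Ioc_eq_integral_Ioo, integral_Ioc_eq_integral_Ioo]
    refine setIntegral_congr_fun measurableSet_Ioo fun x hx => ?_
    have h1 : 0 < 1 - x := by linarith [hx.2]
    have h2 : 0 < 1 + x := by linarith [hx.1]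
    simp only [eval_mul, eval_pow, eval_C, eval_sub, eval_add, eval_one, eval_X, jacobiWeight]
    rw [Real.rpow_add_natCast h1.ne', Real.rpow_add_natCast h2.ne', mul_pow, mul_pow, pow_add,
      add_comm x 1]
    ring
  rw [h, intervalIntegral.integral_const_mul, integral_jacobiWeight hi hj,
    show α + i + (β + j) + 1 = (α + β + 1) + ((i + j : ℕ) : ℝ) by push_cast; ring,
    Real.rpow_add_natCast two_ne_zero, ← mul_assoc, mul_left_comm, ← mul_assoc]
  congr 1
  rw [mul_assoc, ← mul_pow]
  norm_num

theorem jacobiFunctional_comp_neg {α β : ℝ} (hα : -1 < α) (hβ : -1 < β) (p : ℝ[X]) :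
    jacobiFunctional hα hβ (p.comp (-X)) = jacobiFunctional hβ hα p := by
  rw [jacobiFunctional_apply, jacobiFunctional_apply]
  have h := intervalIntegral.integral_comp_neg (a := -1) (b := 1)
    (fun x => jacobiWeight β α x * p.eval x)
  rw [neg_neg] at h
  rw [← h]
  refine intervalIntegral.integral_congr fun x _ => ?_
  simp only [eval_comp, eval_neg, eval_X, jacobiWeight, sub_neg_eq_add]
  rw [← sub_eq_add_neg]
  ring

/-! ### Orthogonality and degree of the Jacobi polynomials -/

theorem Real.Gamma_add_natCast {y : ℝ} (hy : 0 < y) (k : ℕ) :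
    Real.Gamma (y + k) = Real.Gamma y * (ascPochhammer ℝ k).eval y := by
  induction k with
  | zero => simp
  | succ k ih =>
    rw [ascPochhammer_succ_eval, Nat.cast_succ, ← add_assoc,
      Real.Gamma_add_one (by positivity), ih]
    ring

/-- Pascal-type recursion `(k + 1) C(r, k + 1) = (r - k) C(r, k)`. -/
theorem succ_mul_ringChoose_succ (r : ℝ) (k : ℕ) :
    ((k : ℝ) + 1) * Ring.choose r (k + 1) = (r - k) * Ring.choose r k := by
  have h := Ring.choose_smul_choose r (Nat.le_succ k)
  simp only [Nat.succ_eq_add_one, Nat.choose_succ_self_right, nsmul_eq_mul, Nat.add_sub_cancel_left,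
    Ring.choose_one_right] at h
  push_cast at h
  linarith

theorem ringChoose_add_natCast {y : ℝ} (hy : -1 < y) (m : ℕ) :
    Ring.choose (y + m) m = Real.Gamma (y + m + 1) / (Real.Gamma (y + 1) * m.factorial) := by
  induction m generalizing y with
  | zero =>
    have := (Real.Gamma_pos_of_pos (show 0 < y + 1 by linarith)).ne'
    simp [this]
  | succ m ih =>
    -- Shifting `y` keeps the upper argument `y + (m + 1)` fixed, as the recursion in the lower
    -- index requires.
    have h := ih (y := y + 1) (by linarith)
    have h1 := succ_mul_ringChoose_succ (y + (m + 1 : ℕ)) m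
    rw [show y + 1 + (m : ℝ) = y + (m + 1 : ℕ) by push_cast; ring] at h
    rw [h, Real.Gamma_add_one (show y + 1 ≠ 0 by linarith)] at h1
    have h2 := (Real.Gamma_pos_of_pos (show 0 < y + 1 by linarith)).ne'
    have h3 : y + 1 ≠ 0 := by linarith
    have h4 : (m : ℝ) + 1 ≠ 0 := by positivity
    have h5 : (m.factorial : ℝ) ≠ 0 := by positivity
    rw [Nat.factorial_succ]
    apply mul_left_cancel₀ h4
    rw [h1]
    push_cast
    field_simp
    ring

theorem ringChoose_add_natCast_pos {y : ℝ} (hy : -1 < y) (m : ℕ) :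
    0 < Ring.choose (y + m) m := by
  rw [ringChoose_add_natCast hy]
  have h1 := Real.Gamma_pos_of_pos (show 0 < y + 1 by linarith)
  have h2 := Real.Gamma_pos_of_pos (show 0 < y + m + 1 by
    have : (0 : ℝ) ≤ m := m.cast_nonneg
    linarith)
  positivity

/-- The `n`-th finite difference of a polynomial of degree less than `n` vanishes. -/
theorem sum_neg_one_pow_mul_choose_mul_eval_eq_zero {Q : ℝ[X]} {n : ℕ} (hQ : Q.natDegree < n)
    (y : ℝ) : ∑ s ∈ Finset.range (n + 1), (-1 : ℝ) ^ s * n.choose s * Q.eval (y + s) = 0 := by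
  have h := congrFun (Polynomial.fwdDiff_iter_eq_zero_of_degree_lt hQ) y
  rw [fwdDiff_iter_eq_sum_shift] at h
  have h2 : ∑ s ∈ Finset.range (n + 1), (-1 : ℝ) ^ s * n.choose s * Q.eval (y + s) =
      (-1) ^ n * ∑ s ∈ Finset.range (n + 1),
        ((-1 : ℤ) ^ (n - s) * (n.choose s : ℤ)) • Q.eval (y + s • (1 : ℝ)) := by
    rw [Finset.mul_sum]
    refine Finset.sum_congr rfl fun s hs => ?_
    have hs' : s ≤ n := Nat.lt_succ_iff.1 (Finset.mem_range.1 hs)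
    obtain ⟨t, rfl⟩ := Nat.exists_eq_add_of_le hs'
    simp only [Nat.add_sub_cancel_left, zsmul_eq_mul, nsmul_eq_mul, mul_one]
    push_cast
    rw [pow_add, ← mul_assoc, ← mul_assoc, mul_assoc ((-1 : ℝ) ^ s) ((-1) ^ t), ← mul_pow]
    norm_num
  rw [h2, h]
  simp

theorem ringChoose_add_sub {a : ℝ} (ha : -1 < a) {n m : ℕ} (hm : m ≤ n) :
    Ring.choose ((n : ℝ) + a) m =
      Real.Gamma (n + a + 1) / (Real.Gamma (a + (n - m : ℕ) + 1) * m.factorial) := by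
  have h0 : (0 : ℝ) ≤ (n - m : ℕ) := Nat.cast_nonneg _
  have h := ringChoose_add_natCast (y := a + (n - m : ℕ)) (by linarith) m
  have h1 : a + (n - m : ℕ) + (m : ℝ) = n + a := by
    rw [Nat.cast_sub hm]
    ring
  rwa [h1] at h

theorem ringChoose_add_pos {a : ℝ} (ha : -1 < a) {n m : ℕ} (hm : m ≤ n) :
    0 < Ring.choose ((n : ℝ) + a) m := by
  have h0 : (0 : ℝ) ≤ (n - m : ℕ) := Nat.cast_nonneg _
  have h := ringChoose_add_natCast_pos (y := a + (n - m : ℕ)) (by linarith) m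
  have h1 : a + (n - m : ℕ) + (m : ℝ) = n + a := by
    rw [Nat.cast_sub hm]
    ring
  rwa [h1] at h

/-- Each summand is a Beta integral whose exponents add up to `n + k`, so the Gamma factor in the
denominator does not depend on `s`. The rest leaves `(-1) ^ s * n.choose s` times `Γ(α + 1 + s + k)
/ Γ(α + 1 + s)`, a polynomial in `s` of degree `k < n`, and the sum is an `n`-th difference. -/
theorem jacobiFunctional_jacobiPoly_mul_pow {α β : ℝ} (hα : -1 < α) (hβ : -1 < β) {n k : ℕ}
    (hk : k < n) :
    jacobiFunctional hα hβ (jacobiPoly α β n * (C (1 / 2) * (1 - X)) ^ k) = 0 := by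
  have hterm : ∀ s ∈ Finset.range (n + 1), jacobiFunctional hα hβ
      (C (Ring.choose ((n : ℝ) + α) (n - s) * Ring.choose ((n : ℝ) + β) s) *
      (C (1 / 2) * (X - 1)) ^ s * (C (1 / 2) * (X + 1)) ^ (n - s) * (C (1 / 2) * (1 - X)) ^ k) =
      (2 ^ (α + β + 1) * Real.Gamma (n + α + 1) * Real.Gamma (n + β + 1) /
        (Real.Gamma (α + β + n + k + 2) * n.factorial)) *
      ((-1 : ℝ) ^ s * n.choose s * (ascPochhammer ℝ k).eval (α + 1 + s)) := by
    intro s hs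
    have hs' : s ≤ n := Nat.lt_succ_iff.1 (Finset.mem_range.1 hs)
    have h1 : C (Ring.choose ((n : ℝ) + α) (n - s) * Ring.choose ((n : ℝ) + β) s) *
        (C (1 / 2) * (X - 1)) ^ s * (C (1 / 2) * (X + 1)) ^ (n - s) * (C (1 / 2) * (1 - X)) ^ k =
        (Ring.choose ((n : ℝ) + α) (n - s) * Ring.choose ((n : ℝ) + β) s * (-1) ^ s) •
        ((C (1 / 2) * (1 - X)) ^ (s + k) * (C (1 / 2) * (X + 1)) ^ (n - s) : ℝ[X]) := by
      rw [smul_eq_C_mul, C_mul (b := (-1 : ℝ) ^ s), C_pow, C_neg, C_1,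
        show (C (1 / 2) * (X - 1) : ℝ[X]) = (-1) * (C (1 / 2) * (1 - X)) by ring, mul_pow (-1), pow_add]
      ring
    rw [h1, map_smul, jacobiFunctional_pow_mul_pow, smul_eq_mul,
      ringChoose_add_sub hα (Nat.sub_le n s), ringChoose_add_sub hβ hs', Nat.sub_sub_self hs',
      ProbabilityTheory.beta,
      show α + (s + k : ℕ) + 1 + (β + (n - s : ℕ) + 1) = α + β + n + k + 2 by
        rw [Nat.cast_sub hs']; push_cast; ring,
      show α + (s + k : ℕ) + 1 = (α + 1 + s) + (k : ℝ) by push_cast; ring,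
      Real.Gamma_add_natCast (by
        have : (0 : ℝ) ≤ s := s.cast_nonneg
        linarith), show α + s + 1 = α + 1 + s by ring, Nat.cast_choose ℝ hs']
    have e1 := (Real.Gamma_pos_of_pos (show 0 < α + 1 + s by
        have : (0 : ℝ) ≤ s := s.cast_nonneg
        linarith)).ne'
    have e2 := (Real.Gamma_pos_of_pos (show 0 < β + (n - s : ℕ) + 1 by
        have : (0 : ℝ) ≤ (n - s : ℕ) := Nat.cast_nonneg _
        linarith)).ne'
    have e3 : (s.factorial : ℝ) ≠ 0 := by positivity
    have e4 : ((n - s).factorial : ℝ) ≠ 0 := by positivity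
    have e5 : (n.factorial : ℝ) ≠ 0 := by positivity
    have e6 := (Real.Gamma_pos_of_pos (show 0 < α + β + n + k + 2 by
        have : (0 : ℝ) ≤ k := k.cast_nonneg
        have : (0 : ℝ) ≤ n := n.cast_nonneg
        linarith)).ne'
    field_simp
  rw [jacobiPoly, Finset.sum_mul, map_sum, Finset.sum_congr rfl hterm, ← Finset.mul_sum,
    sum_neg_one_pow_mul_choose_mul_eval_eq_zero (by rwa [ascPochhammer_natDegree]), mul_zero]

/-- The Jacobi polynomials are orthogonal with respect to the Jacobi weight. -/
theorem jacobiFunctional_jacobiPoly_mul {α β : ℝ} (hα : -1 < α) (hβ : -1 < β) {n : ℕ} {q : ℝ[X]}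
    (hq : q.natDegree < n) : jacobiFunctional hα hβ (jacobiPoly α β n * q) = 0 := by
  -- Re-expand `q` in powers of `(1 - X) / 2`, for which orthogonality is known.
  have hcomp : q = (q.comp (1 - C 2 * X)).comp (C (1 / 2) * (1 - X)) := by
    rw [comp_assoc]
    have : ((1 - C 2 * X : ℝ[X]).comp (C (1 / 2) * (1 - X))) = X := by
      simp only [sub_comp, one_comp, mul_comp, C_comp, X_comp]
      rw [← mul_assoc, ← C_mul]
      norm_num
    rw [this, comp_X]
  set r := q.comp (1 - C 2 * X) with hr
  have hrdeg : r.natDegree < n := by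
    refine lt_of_le_of_lt (natDegree_comp_le.trans ?_) hq
    have : (1 - C 2 * X : ℝ[X]).natDegree ≤ 1 := by compute_degree
    nlinarith
  rw [hcomp, comp_eq_sum_left, sum_over_range' _ (by simp) n hrdeg, Finset.mul_sum, map_sum]
  refine Finset.sum_eq_zero fun k hk => ?_
  rw [mul_left_comm, ← smul_eq_C_mul, map_smul,
    jacobiFunctional_jacobiPoly_mul_pow hα hβ (Finset.mem_range.1 hk), smul_zero]

/-- For `α, β > -1` every summand contributes a positive coefficient of `X ^ n`, so nothing cancels.
-/
theorem natDegree_jacobiPoly {α β : ℝ} (hα : -1 < α) (hβ : -1 < β) (n : ℕ) :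
    (jacobiPoly α β n).natDegree = n := by
  have hw : (C (1 / 2) * (X - 1) : ℝ[X]).natDegree ≤ 1 := by compute_degree
  have hv : (C (1 / 2) * (X + 1) : ℝ[X]).natDegree ≤ 1 := by compute_degree
  have hw1 : (C (1 / 2) * (X - 1) : ℝ[X]).coeff 1 = 1 / 2 := by
    simp [coeff_one]
  have hv1 : (C (1 / 2) * (X + 1) : ℝ[X]).coeff 1 = 1 / 2 := by
    simp [coeff_one]
  refine natDegree_eq_of_le_of_coeff_ne_zero ?_ (ne_of_gt ?_)
  · refine natDegree_sum_le_of_forall_le _ _ fun s hs => ?_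
    have hs' : s ≤ n := Nat.lt_succ_iff.1 (Finset.mem_range.1 hs)
    rw [mul_assoc]
    refine (natDegree_C_mul_le _ _).trans (natDegree_mul_le.trans ?_)
    have h1 := natDegree_pow_le_of_le s hw
    have h2 := natDegree_pow_le_of_le (n - s) hv
    omega
  · rw [jacobiPoly, finsetSum_coeff]
    refine Finset.sum_pos (fun s hs => ?_) ⟨0, by simp⟩
    have hs' : s ≤ n := Nat.lt_succ_iff.1 (Finset.mem_range.1 hs)
    have h1 := natDegree_pow_le_of_le s hw
    have h2 := natDegree_pow_le_of_le (n - s) hv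
    rw [mul_one] at h1 h2
    have hc := coeff_mul_add_eq_of_natDegree_le h1 h2
    have h3 := coeff_pow_of_natDegree_le (m := s) hw
    have h4 := coeff_pow_of_natDegree_le (m := n - s) hv
    rw [mul_one, hw1] at h3
    rw [mul_one, hv1] at h4
    rw [Nat.add_sub_cancel' hs', h3, h4] at hc
    rw [mul_assoc, coeff_C_mul, hc]
    have := ringChoose_add_pos hα (Nat.sub_le n s)
    have := ringChoose_add_pos hβ hs'
    positivity

/-! ### Two-sided bounds for the least root -/

/-- The values at `-1` of the Jacobi polynomial and of its first two derivatives. -/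
theorem eval_neg_one_jacobiPoly {α β : ℝ} (hβ : -1 < β) (m : ℕ) :
    ∃ c : ℝ, c ≠ 0 ∧ (jacobiPoly α β (m + 2)).eval (-1) = c ∧
      (derivative (jacobiPoly α β (m + 2))).eval (-1) =
        -((m + 2) * (m + 3 + α + β) / (2 * (β + 1))) * c ∧
      (derivative (derivative (jacobiPoly α β (m + 2)))).eval (-1) =
        (m + 2) * (m + 1) * (m + 3 + α + β) * (m + 4 + α + β) / (4 * (β + 1) * (β + 2)) * c := by
  set a0 := Ring.choose (((m + 2 : ℕ) : ℝ) + β) (m + 2) with ha0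
  set a1 := Ring.choose (((m + 2 : ℕ) : ℝ) + β) (m + 1) with ha1
  set a2 := Ring.choose (((m + 2 : ℕ) : ℝ) + β) m with ha2
  have h01 := succ_mul_ringChoose_succ (((m + 2 : ℕ) : ℝ) + β) (m + 1)
  have h12 := succ_mul_ringChoose_succ (((m + 2 : ℕ) : ℝ) + β) m
  have hb := succ_mul_ringChoose_succ (((m + 2 : ℕ) : ℝ) + α) 1
  rw [← ha0, ← ha1] at h01
  rw [← ha1, ← ha2] at h12
  rw [Ring.choose_one_right] at hb
  set b2 := Ring.choose (((m + 2 : ℕ) : ℝ) + α) (1 + 1) with hb2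
  have ha0pos : 0 < a0 := ringChoose_add_pos hβ le_rfl
  -- Summands with `s < m` contain `(X + 1) ^ 3` and do not affect derivatives up to order two at
  -- `-1`.
  obtain ⟨R, hR⟩ : ∃ R : ℝ[X], jacobiPoly α β (m + 2) = (X + 1) ^ 3 * R +
      C (b2 * a2) * (C (1 / 2) * (X - 1)) ^ m * (C (1 / 2) * (X + 1)) ^ 2 +
      C ((((m + 2 : ℕ) : ℝ) + α) * a1) * (C (1 / 2) * (X - 1)) ^ (m + 1) * (C (1 / 2) * (X + 1)) +
      C a0 * (C (1 / 2) * (X - 1)) ^ (m + 2) := by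
    have hdvd : (X + 1 : ℝ[X]) ^ 3 ∣ ∑ s ∈ Finset.range m,
        C (Ring.choose (((m + 2 : ℕ) : ℝ) + α) (m + 2 - s) *
          Ring.choose (((m + 2 : ℕ) : ℝ) + β) s) *
        (C (1 / 2) * (X - 1)) ^ s * (C (1 / 2) * (X + 1)) ^ (m + 2 - s) := by
      refine Finset.dvd_sum fun s hs => ?_
      have hs' : s < m := Finset.mem_range.1 hs
      refine Dvd.dvd.mul_left ?_ _
      rw [mul_pow]
      exact Dvd.dvd.mul_left (pow_dvd_pow _ (by omega)) _
    obtain ⟨R, hR⟩ := hdvd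
    refine ⟨R, ?_⟩
    rw [jacobiPoly, Finset.sum_range_succ, Finset.sum_range_succ, Finset.sum_range_succ, hR,
      show m + 2 - m = 1 + 1 by omega, show m + 2 - (m + 1) = 1 by omega, Nat.sub_self,
      Ring.choose_zero_right, Ring.choose_one_right, pow_one, pow_zero, one_mul, mul_one]
  have hβ1 : β + 1 ≠ 0 := by linarith
  have hβ2 : β + 2 ≠ 0 := by linarith
  have ea1 : a1 = (m + 2) / (β + 1) * a0 := by
    push_cast at h01
    field_simp
    linarith
  have ea2 : a2 = (m + 1) / (β + 2) * a1 := by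
    push_cast at h12
    field_simp
    linarith
  have eb2 : b2 = (m + 2 + α) * (m + 1 + α) / 2 := by
    push_cast at hb
    linarith
  -- At `-1` only the last summand survives, with value `a0 * (-1) ^ (m + 2)`.
  refine ⟨a0 * (-1) ^ m, mul_ne_zero ha0pos.ne' (pow_ne_zero _ (by norm_num)), ?_, ?_, ?_⟩
  · rw [hR]
    simp only [eval_add, eval_mul, eval_pow, eval_X, eval_one, eval_C, eval_sub]
    norm_num
    exact Or.inl (by ring)
  · rw [hR]
    -- Differentiating an `m`-th power creates the truncated exponent `m - 1`, so `m = 0` is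
    -- separate.
    cases m with
    | zero =>
      simp [derivative_mul, derivative_pow, ea2, ea1, eb2]
      field_simp
      ring
    | succ m =>
      simp [derivative_mul, derivative_pow, ea2, ea1, eb2]
      field_simp
      ring
  · rw [hR]
    cases m with
    | zero =>
      simp [derivative_mul, derivative_pow, ea2, ea1, eb2]
      field_simp
      ring
    | succ m =>
      simp [derivative_mul, derivative_pow, ea2, ea1, eb2]
      field_simp
      ring

theorem jacobiFunctional_mul_self_pos {α β : ℝ} (hα : -1 < α) (hβ : -1 < β) (p : ℝ[X])
    (hp : p ≠ 0) : 0 < jacobiFunctional hα hβ (p * p) :=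
  jacobiFunctional_pos hα hβ (mul_ne_zero hp hp) fun x _ => by
    rw [eval_mul]
    exact mul_self_nonneg _

/-- With `S`, `S2` the power sums of `(1 + x)⁻¹` over the roots, positivity gives `(1 + l)⁻¹ ≤ S`,
and minimality of `l` gives `S2 ≤ (1 + l)⁻¹ * S`. The values `P' / P = -S` and `P'' / P = S ^ 2 -
S2` at `-1` make both explicit. -/
theorem isLeast_root_bounds {α β : ℝ} (hα : -1 < α) (hβ : -1 < β) {m : ℕ} {l : ℝ}
    (hl : IsLeast {x | (jacobiPoly α β (m + 2)).IsRoot x} l) :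
    2 * (β + 1) / ((m + 2) * (m + 3 + α + β)) ≤ l + 1 ∧
      l + 1 ≤ 2 * (β + 1) * (β + 2) / ((m + 2) * (m + 3 + α + β)) := by
  set P := jacobiPoly α β (m + 2) with hPdef
  have hdeg : P.natDegree = m + 2 := natDegree_jacobiPoly hα hβ _
  have hP0 : P ≠ 0 := by
    intro h
    rw [h] at hdeg
    simp at hdeg
  have horth : ∀ q : ℝ[X], q.natDegree < P.natDegree → jacobiFunctional hα hβ (P * q) = 0 :=
    fun q hq => jacobiFunctional_jacobiPoly_mul hα hβ (hdeg ▸ hq)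
  have hpos : ∀ r : ℝ[X], r ≠ 0 → (∀ x ∈ Set.Ioo (-1 : ℝ) 1, 0 ≤ r.eval x) →
      0 < jacobiFunctional hα hβ r := fun r hr h => jacobiFunctional_pos hα hβ hr h
  have hsplit := splits_of_orthogonal _ hpos hP0 horth
  have hlt : ∀ x ∈ P.roots, -1 < x := fun x hx =>
    neg_one_lt_of_isRoot_of_orthogonal _ hpos hP0 horth (isRoot_of_mem_roots hx)
  obtain ⟨c, hc0, hc, hc1, hc2⟩ := eval_neg_one_jacobiPoly (α := α) hβ m
  rw [← hPdef] at hc hc1 hc2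
  have hfac := hsplit.eq_prod_roots
  obtain ⟨hd1, hd2⟩ := eval_derivative_prod_X_sub_C (-1) P.roots fun x hx => (hlt x hx).ne
  have hE0 : P.eval (-1) = P.leadingCoeff * ((P.roots.map fun x => X - C x).prod).eval (-1) := by
    conv_lhs => rw [hfac]
    rw [eval_mul, eval_C]
  have hE1 : (derivative P).eval (-1) =
      P.leadingCoeff * (derivative (P.roots.map fun x => X - C x).prod).eval (-1) := by
    conv_lhs => rw [hfac]
    rw [derivative_C_mul, eval_mul, eval_C]
  have hE2 : (derivative (derivative P)).eval (-1) =
      P.leadingCoeff * (derivative (derivative (P.roots.map fun x => X - C x).prod)).eval (-1) := by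
    conv_lhs => rw [hfac]
    rw [derivative_C_mul, derivative_C_mul, eval_mul, eval_C]
  set S := (P.roots.map fun x => (1 + x)⁻¹).sum with hS
  set S2 := (P.roots.map fun x => (1 + x)⁻¹ ^ 2).sum with hS2
  have hS' : (P.roots.map fun x => (-1 - x)⁻¹).sum = -S := by
    rw [hS, ← Multiset.sum_map_neg]
    congr 1
    refine Multiset.map_congr rfl fun x _ => ?_
    rw [← inv_neg]
    congr 1
    ring
  have hS2' : (P.roots.map fun x => (-1 - x)⁻¹ ^ 2).sum = S2 := by
    rw [hS2]
    congr 1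
    refine Multiset.map_congr rfl fun x _ => ?_
    rw [show -1 - x = -(1 + x) by ring, inv_neg, neg_sq]
  have hs1 : S = (m + 2) * (m + 3 + α + β) / (2 * (β + 1)) := by
    rw [hd1, hS', mul_left_comm, ← hE0, hc1, hc] at hE1
    have := mul_right_cancel₀ hc0 hE1
    linarith
  have hs2 : S ^ 2 - S2 =
      (m + 2) * (m + 1) * (m + 3 + α + β) * (m + 4 + α + β) / (4 * (β + 1) * (β + 2)) := by
    rw [hd2, hS', hS2', mul_left_comm, ← hE0, hc2, hc] at hE2
    have := mul_right_cancel₀ hc0 hE2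
    rw [this]
    ring
  have hm : (0 : ℝ) ≤ m := m.cast_nonneg
  have hb1 : 0 < β + 1 := by linarith
  have hb2 : 0 < β + 2 := by linarith
  have hD : 0 < (m + 2) * (m + 3 + α + β) := mul_pos (by linarith) (by linarith)
  have hlmem : l ∈ P.roots := (mem_roots hP0).2 hl.1
  have hl1 : 0 < 1 + l := by linarith [hlt l hlmem]
  have hle1 : (1 + l)⁻¹ ≤ S := by
    refine Multiset.single_le_sum (fun y hy => ?_) _ (Multiset.mem_map_of_mem _ hlmem)
    obtain ⟨x, hx, rfl⟩ := Multiset.mem_map.1 hy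
    exact inv_nonneg.2 (by linarith [hlt x hx])
  have hle2 : S2 ≤ (1 + l)⁻¹ * S := by
    rw [hS, ← Multiset.sum_map_mul_left]
    refine Multiset.sum_map_le_sum_map _ _ fun x hx => ?_
    have hx1 := hlt x hx
    have hlx : l ≤ x := hl.2 (isRoot_of_mem_roots hx)
    rw [sq]
    exact mul_le_mul_of_nonneg_right (inv_anti₀ hl1 (by linarith))
      (inv_nonneg.2 (by linarith))
  constructor
  · rw [hs1] at hle1
    rw [add_comm l 1, ← inv_inv (1 + l), ← inv_div]
    exact inv_anti₀ (inv_pos.2 hl1) hle1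
  · have hSpos : 0 < S := hs1 ▸ div_pos hD (by linarith)
    have h1 : S * ((m + 2) * (m + 3 + α + β) / (2 * (β + 1) * (β + 2))) ≤ S2 := by
      have e : S2 = S ^ 2 -
        (m + 2) * (m + 1) * (m + 3 + α + β) * (m + 4 + α + β) / (4 * (β + 1) * (β + 2)) := by
        linarith
      -- The exact quotient `S2 / S` exceeds the claimed bound by `(α + β + 2) / (2 * (β + 2))`,
      -- which is positive and dropped.
      have e2 : S2 - S * ((m + 2) * (m + 3 + α + β) / (2 * (β + 1) * (β + 2))) =
          S * ((α + β + 2) / (2 * (β + 2))) := by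
        rw [e, hs1]
        field_simp
        ring
      have : 0 ≤ S * ((α + β + 2) / (2 * (β + 2))) :=
        mul_nonneg hSpos.le (div_nonneg (by linarith) (by linarith))
      linarith
    have h2 : (m + 2) * (m + 3 + α + β) / (2 * (β + 1) * (β + 2)) ≤ (1 + l)⁻¹ := by
      refine le_of_mul_le_mul_left ?_ hSpos
      linarith
    rw [add_comm l 1, ← inv_inv (1 + l), ← inv_div]
    exact inv_anti₀ (div_pos hD (by positivity)) h2

/-! ### The Lasserre bound as a least root, and its rate -/

theorem mem_lasserreValues_jacobiMeasure {α β : ℝ} (hα : -1 < α) (hβ : -1 < β) (f : ℝ[X]) (d : ℕ)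
    (v : ℝ) : v ∈ lasserreValues (Set.Icc (-1) 1) (jacobiMeasure α β) f d ↔
      ∃ σ : ℝ[X], IsSumSq σ ∧ σ.natDegree ≤ 2 * d ∧ jacobiFunctional hα hβ σ = 1 ∧
        jacobiFunctional hα hβ (f * σ) = v := by
  simp only [lasserreValues, Set.mem_ofPred_eq, setIntegral_Icc_jacobiMeasure,
    jacobiFunctional_apply, mul_comm f, eval_mul]

/-- The substitution `X ↦ -X` preserves sums of squares and degrees and exchanges the two exponents.
-/
theorem lasserreValues_neg_X {α β : ℝ} (hα : -1 < α) (hβ : -1 < β) (d : ℕ) :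
    lasserreValues (Set.Icc (-1) 1) (jacobiMeasure α β) (-X) d =
      lasserreValues (Set.Icc (-1) 1) (jacobiMeasure β α) X d := by
  have hinv : ∀ σ : ℝ[X], (σ.comp (-X)).comp (-X) = σ := fun σ => by
    rw [comp_assoc, neg_comp, X_comp, neg_neg, comp_X]
  have hsos : ∀ σ : ℝ[X], IsSumSq σ → IsSumSq (σ.comp (-X)) := fun σ h => by
    induction h with
    | zero => simp
    | sq_add a hs ih =>
      rw [add_comp, mul_comp]
      exact (IsSumSq.mul_self _).add ih
  have hdeg : ∀ σ : ℝ[X], (σ.comp (-X)).natDegree = σ.natDegree := fun σ => by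
    rw [natDegree_comp, natDegree_neg, natDegree_X, mul_one]
  ext v
  rw [mem_lasserreValues_jacobiMeasure hα hβ, mem_lasserreValues_jacobiMeasure hβ hα]
  constructor
  · rintro ⟨σ, h1, h2, h3, h4⟩
    refine ⟨σ.comp (-X), hsos σ h1, (hdeg σ).trans_le h2, ?_, ?_⟩
    · rw [jacobiFunctional_comp_neg, h3]
    · rw [← h4, ← jacobiFunctional_comp_neg hβ hα, mul_comp, neg_comp, X_comp, neg_neg]
  · rintro ⟨σ, h1, h2, h3, h4⟩
    refine ⟨σ.comp (-X), hsos σ h1, (hdeg σ).trans_le h2, ?_, ?_⟩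
    · rw [jacobiFunctional_comp_neg, h3]
    · rw [← h4, ← jacobiFunctional_comp_neg hα hβ, mul_comp, X_comp]

/-- The Lasserre bound for `X` is attained, and equals the least root of any polynomial of degree
`d + 1` which is orthogonal to all polynomials of degree at most `d`. -/
theorem exists_isLeast_lasserreValues_X {α β : ℝ} (hα : -1 < α) (hβ : -1 < β) {d : ℕ} {P : ℝ[X]}
    (hP : P.natDegree = d + 1)
    (horth : ∀ q : ℝ[X], q.natDegree ≤ d → jacobiFunctional hα hβ (P * q) = 0) :
    ∃ l, IsLeast {x | P.IsRoot x} l ∧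
      IsLeast (lasserreValues (Set.Icc (-1) 1) (jacobiMeasure α β) X d) l := by
  obtain ⟨l, hl, ⟨p, hp0, hpd, hp⟩, hmin⟩ :=
    exists_isLeast_root_of_orthogonal _ (jacobiFunctional_mul_self_pos hα hβ) hP horth
  refine ⟨l, hl, ?_, ?_⟩
  · rw [mem_lasserreValues_jacobiMeasure hα hβ]
    have hpp := jacobiFunctional_mul_self_pos hα hβ p hp0
    set N := jacobiFunctional hα hβ (p * p) with hN
    -- Dividing the minimiser by `√N` turns its square into a density of integral `1`.
    have hsq : (C (Real.sqrt N)⁻¹ * p) * (C (Real.sqrt N)⁻¹ * p) = N⁻¹ • (p * p) := by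
      rw [smul_eq_C_mul, mul_mul_mul_comm, ← C_mul, ← mul_inv, Real.mul_self_sqrt hpp.le]
    refine ⟨(C (Real.sqrt N)⁻¹ * p) * (C (Real.sqrt N)⁻¹ * p), IsSumSq.mul_self _, ?_, ?_, ?_⟩
    · have := (natDegree_C_mul_le (Real.sqrt N)⁻¹ p).trans hpd
      exact natDegree_mul_le.trans (by omega)
    · rw [hsq, map_smul, ← hN, smul_eq_mul, inv_mul_cancel₀ hpp.ne']
    · rw [hsq, mul_smul_comm, map_smul, hp, smul_eq_mul, mul_left_comm, inv_mul_cancel₀ hpp.ne',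
        mul_one]
  · intro v hv
    obtain ⟨σ, h1, h2, h3, rfl⟩ := (mem_lasserreValues_jacobiMeasure hα hβ X d v).1 hv
    simpa [h3] using mul_le_of_isSumSq _ hmin h1 h2

theorem isLeast_lasserreBound_X {α β : ℝ} (hα : -1 < α) (hβ : -1 < β) (d : ℕ) :
    IsLeast {x | (jacobiPoly α β (d + 1)).IsRoot x}
        (lasserreBound (Set.Icc (-1) 1) (jacobiMeasure α β) X d) ∧
      IsLeast (lasserreValues (Set.Icc (-1) 1) (jacobiMeasure α β) X d)
        (lasserreBound (Set.Icc (-1) 1) (jacobiMeasure α β) X d) := by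
  obtain ⟨l, h1, h2⟩ := exists_isLeast_lasserreValues_X hα hβ
    (natDegree_jacobiPoly hα hβ (d + 1))
    fun q hq => jacobiFunctional_jacobiPoly_mul hα hβ (Nat.lt_succ_of_le hq)
  have h3 : lasserreBound (Set.Icc (-1) 1) (jacobiMeasure α β) X d = l := h2.csInf_eq
  rw [h3]
  exact ⟨h1, h2⟩

theorem neg_one_lt_lasserreBound_X {α β : ℝ} (hα : -1 < α) (hβ : -1 < β) (d : ℕ) :
    -1 < lasserreBound (Set.Icc (-1) 1) (jacobiMeasure α β) X d := by
  have hdeg := natDegree_jacobiPoly hα hβ (d + 1)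
  refine neg_one_lt_of_isRoot_of_orthogonal (jacobiFunctional hα hβ)
    (fun r hr h => jacobiFunctional_pos hα hβ hr h) (fun h => ?_)
    (fun q hq => jacobiFunctional_jacobiPoly_mul hα hβ (hdeg ▸ hq))
    (isLeast_lasserreBound_X hα hβ d).1.1
  rw [h] at hdeg
  simp at hdeg

theorem lasserreBound_X_add_one_isTheta {α β : ℝ} (hα : -1 < α) (hβ : -1 < β) :
    (fun d : ℕ => lasserreBound (Set.Icc (-1) 1) (jacobiMeasure α β) X d + 1) =Θ[atTop]
      fun d : ℕ => 1 / (d : ℝ) ^ 2 := by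
  have hb1 : 0 < β + 1 := by linarith
  have hb2 : 0 < β + 2 := by linarith
  -- The root bounds start at degree `2`, that is `d = m + 1`. The constants come from `m + 1 ≤ m +
  -- 2 ≤ 2 (m + 1)` and `m + 1 ≤ m + 3 + α + β ≤ (α + β + 3) (m + 1)`, using `α + β > -2`.
  have key : ∀ d : ℕ, 1 ≤ d →
      (β + 1) / (α + β + 3) * (1 / (d : ℝ) ^ 2) ≤
          lasserreBound (Set.Icc (-1) 1) (jacobiMeasure α β) X d + 1 ∧
        lasserreBound (Set.Icc (-1) 1) (jacobiMeasure α β) X d + 1 ≤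
          2 * (β + 1) * (β + 2) * (1 / (d : ℝ) ^ 2) := by
    intro d hd
    obtain ⟨m, rfl⟩ := Nat.exists_eq_add_of_le' hd
    obtain ⟨h1, h2⟩ := isLeast_root_bounds hα hβ (isLeast_lasserreBound_X hα hβ (m + 1)).1
    have hm : (0 : ℝ) ≤ m := m.cast_nonneg
    have hD : 0 < (m + 2) * (m + 3 + α + β) := mul_pos (by linarith) (by linarith)
    have hd0 : (0 : ℝ) < ((m + 1 : ℕ) : ℝ) ^ 2 := by positivity
    constructor
    · refine le_trans ?_ h1
      rw [div_mul_div_comm, mul_one, div_le_div_iff₀ (mul_pos (by linarith) hd0) hD]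
      have e1 : (m + 2 : ℝ) ≤ 2 * (m + 1) := by linarith
      have e2 : m + 3 + α + β ≤ (α + β + 3) * (m + 1) := by nlinarith
      have e3 : (m + 2) * (m + 3 + α + β) ≤ 2 * (m + 1) * ((α + β + 3) * (m + 1)) :=
        mul_le_mul e1 e2 (by linarith) (by linarith)
      push_cast
      calc (β + 1) * ((m + 2) * (m + 3 + α + β))
          ≤ (β + 1) * (2 * (m + 1) * ((α + β + 3) * (m + 1))) :=
            mul_le_mul_of_nonneg_left e3 hb1.le
        _ = _ := by ring
    · refine h2.trans ?_
      rw [mul_one_div]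
      refine div_le_div_of_nonneg_left (by positivity) hd0 ?_
      push_cast
      rw [sq]
      exact mul_le_mul (by linarith) (by linarith) (by linarith) (by linarith)
  constructor
  · refine IsBigO.of_bound (2 * (β + 1) * (β + 2)) ?_
    filter_upwards [eventually_ge_atTop 1] with d hd
    rw [Real.norm_of_nonneg (by linarith [neg_one_lt_lasserreBound_X hα hβ d]),
      Real.norm_of_nonneg (by positivity)]
    exact (key d hd).2
  · refine IsBigO.of_bound ((β + 1) / (α + β + 3))⁻¹ ?_
    filter_upwards [eventually_ge_atTop 1] with d hd
    rw [Real.norm_of_nonneg (r := lasserreBound _ _ _ _ + 1)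
        (by linarith [neg_one_lt_lasserreBound_X hα hβ d]),
      Real.norm_of_nonneg (by positivity)]
    rw [le_inv_mul_iff₀ (div_pos hb1 (by linarith))]
    exact (key d hd).1

theorem polyMin_X : polyMin (Set.Icc (-1) 1) X = -1 := by
  refine IsLeast.csInf_eq ⟨⟨-1, by norm_num, by simp⟩, ?_⟩
  rintro _ ⟨x, hx, rfl⟩
  simpa using hx.1

theorem polyMin_neg_X : polyMin (Set.Icc (-1) 1) (-X) = -1 := by
  refine IsLeast.csInf_eq ⟨⟨1, by norm_num, by simp⟩, ?_⟩
  rintro _ ⟨x, hx, rfl⟩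
  simpa using hx.2

/-! ### The Chebyshev case -/

theorem jacobiFunctional_neg_half (h h' : (-1 : ℝ) < -1 / 2) (p : ℝ[X]) :
    jacobiFunctional h h' p = ∫ x, p.eval x ∂Chebyshev.measureT := by
  rw [Chebyshev.integral_measureT, jacobiFunctional_apply,
    intervalIntegral.integral_of_le (by norm_num), intervalIntegral.integral_of_le (by norm_num),
    integral_Ioc_eq_integral_Ioo, integral_Ioc_eq_integral_Ioo]
  refine setIntegral_congr_fun measurableSet_Ioo fun x hx => ?_
  have h1 : 0 < 1 - x := by linarith [hx.2]
  have h2 : 0 < 1 + x := by linarith [hx.1]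
  simp only [jacobiWeight]
  rw [← Real.mul_rpow h1.le h2.le, show (1 - x) * (1 + x) = 1 - x ^ 2 by ring, Real.sqrt_inv,
    Real.sqrt_eq_rpow, neg_div, Real.rpow_neg (by nlinarith), mul_comm]

theorem jacobiFunctional_chebyshev_mul (h h' : (-1 : ℝ) < -1 / 2) (n : ℕ) (q : ℝ[X])
    (hq : q.natDegree < n) : jacobiFunctional h h' (Chebyshev.T ℝ n * q) = 0 := by
  induction hk : q.natDegree using Nat.strong_induction_on generalizing q with
  | _ k ih =>
    have hTdeg : (Chebyshev.T ℝ k).natDegree = k := by simp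
    have hT0 : Chebyshev.T ℝ k ≠ 0 := Chebyshev.T_ne_zero ℝ k
    have hTT : jacobiFunctional h h' (Chebyshev.T ℝ n * Chebyshev.T ℝ k) = 0 := by
      rw [jacobiFunctional_neg_half]
      simp only [eval_mul]
      exact Chebyshev.integral_eval_T_real_mul_eval_T_real_measureT_of_ne (by omega)
    set c := q.coeff k / (Chebyshev.T ℝ k).coeff k with hc
    have hlead : (Chebyshev.T ℝ k).coeff k ≠ 0 := by
      have := leadingCoeff_ne_zero.2 hT0
      rwa [leadingCoeff, hTdeg] at this
    set r := q - c • Chebyshev.T ℝ k with hr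
    have hdec : q = c • Chebyshev.T ℝ k + r := by rw [hr]; ring
    have hrk : r.coeff k = 0 := by
      rw [hr, coeff_sub, coeff_smul, smul_eq_mul, hc, div_mul_cancel₀ _ hlead, sub_self]
    have hrle : r.natDegree ≤ k :=
      (natDegree_sub_le _ _).trans (max_le hk.le ((natDegree_smul_le _ _).trans hTdeg.le))
    have hr0 : jacobiFunctional h h' (Chebyshev.T ℝ n * r) = 0 := by
      rcases hrle.lt_or_eq with hlt | heq
      -- The alternative, degree still `k` with vanishing `k`-th coefficient, forces `r = 0`; this
      -- includes `k = 0`.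
      · exact ih _ hlt r (by omega) rfl
      · have : r = 0 := by
          rw [← leadingCoeff_eq_zero, leadingCoeff, heq, hrk]
        rw [this, mul_zero, map_zero]
    rw [hdec, mul_add, map_add, mul_smul_comm, map_smul, hTT, hr0]
    simp

/-- The roots are `cos ((2k + 1) π / (2d + 2))` for `k ≤ d`; cosine decreases on `[0, π]`, so `k =
d` gives the least. -/
theorem isLeast_isRoot_chebyshev_T (d : ℕ) :
    IsLeast {x | (Chebyshev.T ℝ (d + 1 : ℕ)).IsRoot x} (-Real.cos (Real.pi / (2 * (d : ℝ) + 2))) := by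
  have hroots : ∀ x, (Chebyshev.T ℝ (d + 1 : ℕ)).IsRoot x ↔
      ∃ k < d + 1, Real.cos ((2 * k + 1) * Real.pi / (2 * (d + 1 : ℕ))) = x := by
    intro x
    rw [← mem_roots (Chebyshev.T_ne_zero ℝ _), Chebyshev.roots_T_real, Finset.mem_val,
      Finset.mem_image]
    simp only [Finset.mem_range]
  have hd : (0 : ℝ) < 2 * d + 2 := by positivity
  have hlast : -Real.cos (Real.pi / (2 * (d : ℝ) + 2)) =
      Real.cos ((2 * d + 1) * Real.pi / (2 * (d + 1 : ℕ))) := by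
    rw [← Real.cos_pi_sub]
    congr 1
    push_cast
    field_simp
    ring
  refine ⟨(hroots _).2 ⟨d, Nat.lt_succ_self d, hlast.symm⟩, fun x hx => ?_⟩
  obtain ⟨k, hk, rfl⟩ := (hroots x).1 hx
  have hkd : (k : ℝ) ≤ d := by exact_mod_cast Nat.le_of_lt_succ hk
  have hpi := Real.pi_pos
  rw [hlast]
  refine Real.cos_le_cos_of_nonneg_of_le_pi (by positivity) ?_ ?_
  · rw [div_le_iff₀ (by positivity)]
    push_cast
    nlinarith
  · gcongr

/-- Any orthogonal polynomial of degree `d + 1` computes the bound, so `Chebyshev.T` can be used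
without comparing it to `jacobiPoly`. -/
theorem lasserreBound_X_chebyshev (d : ℕ) :
    lasserreBound (Set.Icc (-1) 1) (jacobiMeasure (-1 / 2) (-1 / 2)) X d =
      -Real.cos (Real.pi / (2 * (d : ℝ) + 2)) := by
  have h : (-1 : ℝ) < -1 / 2 := by norm_num
  obtain ⟨l, h1, h2⟩ := exists_isLeast_lasserreValues_X h h
    (P := Chebyshev.T ℝ (d + 1 : ℕ)) (d := d) (by simp; omega)
    fun q hq => jacobiFunctional_chebyshev_mul h h (d + 1) q (Nat.lt_succ_of_le hq)
  have h3 : lasserreBound (Set.Icc (-1) 1) (jacobiMeasure (-1 / 2) (-1 / 2)) X d = l := h2.csInf_eq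
  rw [h3]
  exact h1.unique (isLeast_isRoot_chebyshev_T d)

/-! ### The main theorem -/

theorem corollary3p2 (α β : ℝ) (hα : -1 < α) (hβ : -1 < β) :
    (∀ d : ℕ, IsLeast {x : ℝ | (jacobiPoly α β (d + 1)).IsRoot x}
      (lasserreBound (Set.Icc (-1) 1) (jacobiMeasure α β) X d)) ∧
    (∀ d : ℕ, IsLeast {x : ℝ | (jacobiPoly β α (d + 1)).IsRoot x}
      (lasserreBound (Set.Icc (-1) 1) (jacobiMeasure α β) (-X) d)) ∧
    ∀ f : ℝ[X], f = X ∨ f = -X →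
      (∀ d : ℕ, IsGLB (lasserreValues (Set.Icc (-1) 1) (jacobiMeasure α β) f d)
        (lasserreBound (Set.Icc (-1) 1) (jacobiMeasure α β) f d)) ∧
      (∀ d : ℕ, polyMin (Set.Icc (-1) 1) f ≤
        lasserreBound (Set.Icc (-1) 1) (jacobiMeasure α β) f d) ∧
      ((fun d : ℕ => lasserreBound (Set.Icc (-1) 1) (jacobiMeasure α β) f d -
          polyMin (Set.Icc (-1) 1) f) =Θ[atTop] fun d : ℕ => 1 / (d : ℝ) ^ 2) ∧
      (α = -1 / 2 → β = -1 / 2 → ∀ d : ℕ,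
        lasserreBound (Set.Icc (-1) 1) (jacobiMeasure α β) f d =
          -Real.cos (Real.pi / (2 * (d : ℝ) + 2))) := by
  have hneg : ∀ d, lasserreBound (Set.Icc (-1) 1) (jacobiMeasure α β) (-X) d =
      lasserreBound (Set.Icc (-1) 1) (jacobiMeasure β α) X d := fun d => by
    rw [lasserreBound, lasserreBound, lasserreValues_neg_X hα hβ]
  refine ⟨fun d => (isLeast_lasserreBound_X hα hβ d).1, fun d => ?_, ?_⟩
  · rw [hneg]
    exact (isLeast_lasserreBound_X hβ hα d).1
  rintro f (rfl | rfl)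
  · refine ⟨fun d => (isLeast_lasserreBound_X hα hβ d).2.isGLB, fun d => ?_, ?_, ?_⟩
    · rw [polyMin_X]
      exact (neg_one_lt_lasserreBound_X hα hβ d).le
    · simpa only [polyMin_X, sub_neg_eq_add] using lasserreBound_X_add_one_isTheta hα hβ
    · rintro rfl rfl d
      exact lasserreBound_X_chebyshev d
  · simp only [hneg, polyMin_neg_X, sub_neg_eq_add, lasserreValues_neg_X hα hβ]
    refine ⟨fun d => (isLeast_lasserreBound_X hβ hα d).2.isGLB, fun d => ?_,
      lasserreBound_X_add_one_isTheta hβ hα, ?_⟩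
    · exact (neg_one_lt_lasserreBound_X hβ hα d).le
    · rintro rfl rfl d
      exact lasserreBound_X_chebyshev d
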